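/- **Setting (LF with refinements, LFR, canonical forms).** The grammar, up to renaming of bound variables, is: atomic terms $R ::= c \mid x \mid R\,N$ and normal terms $N ::= R \mid \lambda x.\,N$; types $P ::= a \mid P\,N$, $A ::= P \mid \Pi x{:}A_1.\,A_2$; sorts $Q ::= s \mid Q\,N$, $S,T ::= Q \mid \Pi x{::}S_1{\sqsubset}A_1.\,S_2 \mid \top \mid S_1\wedge S_2$; kinds $K ::= \mathsf{type} \mid \Pi x{:}A.\,K$; classes $L ::= \mathsf{sort} \mid \Pi x{::}S{\sqsubset}A.\,L \mid \top \mid L_1\wedge L_2$. A signature $\Sigma$ consists of declarations $a{:}K$, $c{:}A$, $s{\sqsubset}a{::}L$, $s_1\le s_2$, $c{::}S$, and a context $\Gamma$ of declarations $x{::}S{\sqsubset}A$; $\Sigma^*$ keeps only the declarations $a{:}K$, $c{:}A$ of $\Sigma$, and $\Gamma^*$ replaces each $x{::}S{\sqsubset}A$ by $x{:}A$. Types erase to simple types by $|a\,N_1\cdots N_n| = a$ and $|\Pi x{:}A.\,B| = |A|\to|B|$. The $\eta$-expansion is $\eta_a(R)=R$, $\eta_{\alpha\to\beta}(R)=\lambda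 x.\,\eta_\beta(R\;\eta_\alpha(x))$, and $\eta_A := \eta_{|A|}$. $[N/x]_A$ denotes hereditary substitution (substitution that contracts, at the simple type $|A|$, the redexes it creates), a partial operation. Atomic subsorting $Q\le Q'$ is the reflexive-transitive closure of $s_1\,N_1\cdots N_n\le s_2\,N_1\cdots N_n$ for $s_1\le s_2\in\Sigma$. Sort synthesis $\Gamma\vdash R\Rightarrow S$ and sort checking $\Gamma\vdash N\Leftarrow S$ are defined by: $\Gamma\vdash c\Rightarrow S$ if $c{::}S\in\Sigma$; $\Gamma\vdash x\Rightarrow S$ if $x{::}S{\sqsubset}A\in\Gamma$; if $\Gamma\vdash R\Rightarrow\Pi x{::}S{\sqsubset}A.\,T$, $\Gamma\vdash N\Leftarrow S$ and $[N/x]_A T=T'$, then $\Gamma\vdash R\,N\Rightarrow T'$; if $\Gamma\vdash R\Rightarrow S_1\wedge S_2$, then $\Gamma\vdash R\Rightarrow S_i$ for $i=1,2$; if $\Gamma\vdash R\Rightarrow Q'$ and $Q'\le Q$, then $\Gamma\vdash R\Leftarrow Q$; if $\Gamma,x{::}S{\sqsubset}A\vdash N\Leftarrow T$, then $\Gamma\vdash\lambda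 x.N\Leftarrow\Pi x{::}S{\sqsubset}A.\,T$; $\Gamma\vdash N\Leftarrow\top$ always; if $\Gamma\vdash N\Leftarrow S_1$ and $\Gamma\vdash N\Leftarrow S_2$, then $\Gamma\vdash N\Leftarrow S_1\wedge S_2$. Sort formation is defined by: $\Gamma\vdash s\sqsubset a\Rightarrow L$ if $s{\sqsubset}a{::}L\in\Sigma$; if $\Gamma\vdash Q\sqsubset P\Rightarrow\Pi x{::}S{\sqsubset}A.\,L$, $\Gamma\vdash N\Leftarrow S$ and $[N/x]_A L=L'$, then $\Gamma\vdash Q\,N\sqsubset P\,N\Rightarrow L'$; if $\Gamma\vdash Q\sqsubset P\Rightarrow L_1\wedge L_2$, then $\Gamma\vdash Q\sqsubset P\Rightarrow L_i$; if $\Gamma\vdash Q\sqsubset P\Rightarrow\mathsf{sort}$, then $\Gamma\vdash Q\sqsubset P$; if $\Gamma\vdash S\sqsubset A$ and $\Gamma,x{::}S{\sqsubset}A\vdash T\sqsubset B$, then $\Gamma\vdash\Pi x{::}S{\sqsubset}A.\,T\sqsubset\Pi x{:}A.\,B$; $\Gamma\vdash\top\sqsubset A$; if $\Gamma\vdash S_1\sqsubset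 A$ and $\Gamma\vdash S_2\sqsubset A$, then $\Gamma\vdash S_1\wedge S_2\sqsubset A$. Refinement of kinds by classes, $\Gamma\vdash L\sqsubset K$, is defined likewise from $\mathsf{sort}\sqsubset\mathsf{type}$. LF judgments, such as $\Gamma^*\vdash A\Leftarrow\mathsf{type}$, are those of canonical LF over $\Sigma^*$. A context is well-formed if each $x{::}S{\sqsubset}A$ in it satisfies $S\sqsubset A$ in the context before it. A signature is well-formed if, over the signature before it, each $a{:}K$ and $c{:}A$ has $K$ a kind and $A$ a type of LF over the erased signature, each $s{\sqsubset}a{::}L$ has $a{:}K$ declared with $L\sqsubset K$, each $c{::}S$ has $c{:}A$ declared with $S\sqsubset A$, each $s_1\le s_2$ has $s_1{\sqsubset}a{::}L$ and $s_2{\sqsubset}a{::}L$ declared for the same $a$ and $L$, and no constant receives two declarations of the same one of the forms $a{:}K$, $c{:}A$, $s{\sqsubset}a{::}L$, $c{::}S$. *Declarative subsorting* $\Gamma\vdash S\le T\sqsubset A$ is the least relation that contains atomic subsorting ($\Gamma\vdash Q\le Q'\sqsubset P$ whenever $Q\le Q'$) and is closed under the rules (with $\Gamma$ and $A$ fixed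 where not shown, and $\Pi x{::}S.\,T$ short for $\Pi x{::}S{\sqsubset}A.\,T$ in judgments at $\Pi x{:}A.\,A'$): - reflexivity $S\le S$ and transitivity; - if $\Gamma\vdash S_2\le S_1\sqsubset A$ and $\Gamma,x{::}S_2{\sqsubset}A\vdash T_1\le T_2\sqsubset A'$, then $\Gamma\vdash \Pi x{::}S_1.\,T_1\le\Pi x{::}S_2.\,T_2\sqsubset\Pi x{:}A.\,A'$; - $S\le\top$; if $T\le S_1$ and $T\le S_2$, then $T\le S_1\wedge S_2$; if $S_1\le T$ or $S_2\le T$, then $S_1\wedge S_2\le T$; - $\top\le\Pi x{::}S.\,\top$ and $(\Pi x{::}S.\,T_1)\wedge(\Pi x{::}S.\,T_2)\le\Pi x{::}S.\,(T_1\wedge T_2)$, both at $\Pi x{:}A.\,A'$. **Theorem (Soundness of Declarative Subsorting).** Let $\Sigma$ be a well-formed signature, $\Gamma$ a well-formed context whose erasure $\Gamma^*$ is a well-formed LF context, $A$ a type with $\Gamma^*\vdash A\Leftarrow\mathsf{type}$, and $S,T$ sorts with $\Gamma\vdash S\sqsubset A$ and $\Gamma\vdash T\sqsubset A$. If $\Gamma\vdash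 S\le T\sqsubset A$ is derivable, then $$\Gamma,\,x{::}S{\sqsubset}A\;\vdash\;\eta_A(x)\Leftarrow T .$$ -/

import Mathlib

/-! LF with refinements (LFR), in the canonical-forms style.

Terms are represented up to renaming of bound variables by de Bruijn indices.  Contexts are lists
whose head is the most recent declaration; the classifiers of an entry live in the tail of the
list after that entry. Names of constants are natural numbers, with one name space each for type
family constants `a`, sort family constants `s` and term constants `c`. -/

namespace LFR

/-! ### Grammar -/

mutual
/-- Atomic terms `R ::= c | x | R N`. -/
inductive Atm : Type
  | const (c : ℕ) : Atm
  | var (i : ℕ) : Atm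
  | app (R : Atm) (N : Nrm) : Atm
/-- Normal terms `N ::= R | λx. N`. -/
inductive Nrm : Type
  | atom (R : Atm) : Nrm
  | lam (N : Nrm) : Nrm
end

/-- Atomic type families `P ::= a | P N`. -/
inductive ATy : Type
  | const (a : ℕ) : ATy
  | app (P : ATy) (N : Nrm) : ATy

/-- Normal type families `A ::= P | Πx:A₁. A₂`. -/
inductive Ty : Type
  | atom (P : ATy) : Ty
  | pi (A B : Ty) : Ty

/-- Atomic sort families `Q ::= s | Q N`. -/
inductive ASrt : Type
  | const (s : ℕ) : ASrt
  | app (Q : ASrt) (N : Nrm) : ASrt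

/-- Normal sort families `S ::= Q | Πx::S₁⊏A₁. S₂ | ⊤ | S₁ ∧ S₂`. -/
inductive Srt : Type
  | atom (Q : ASrt) : Srt
  | pi (S : Srt) (A : Ty) (T : Srt) : Srt
  | top : Srt
  | inter (S T : Srt) : Srt

/-- Kinds `K ::= type | Πx:A. K`. -/
inductive Knd : Type
  | type : Knd
  | pi (A : Ty) (K : Knd) : Knd

/-- Classes `L ::= sort | Πx::S⊏A. L | ⊤ | L₁ ∧ L₂`. -/
inductive Cls : Type
  | sort : Cls
  | pi (S : Srt) (A : Ty) (L : Cls) : Cls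
  | top : Cls
  | inter (L₁ L₂ : Cls) : Cls

/-- Declarations `D ::= a:K | c:A | s⊏a::L | s₁≤s₂ | c::S`. -/
inductive Decl : Type
  | tyDecl (a : ℕ) (K : Knd) : Decl
  | tmDecl (c : ℕ) (A : Ty) : Decl
  | srtRef (s a : ℕ) (L : Cls) : Decl
  | subDecl (s₁ s₂ : ℕ) : Decl
  | tmRef (c : ℕ) (S : Srt) : Decl

/-- Signatures, most recent declaration first. -/
abbrev Sig := List Decl

/-- LFR contexts: an entry `(S, A)` is a declaration `x::S⊏A`. -/
abbrev Ctx := List (Srt × Ty)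

/-- LF contexts: an entry `A` is a declaration `x:A`. -/
abbrev LFCtx := List Ty

/-- Whether a declaration is one of pure LF. -/
def Decl.isLF : Decl → Bool
  | .tyDecl _ _ => true
  | .tmDecl _ _ => true
  | _ => false

/-- Erasure of the refinement declarations from a signature. -/
def Sig.erase (Sg : Sig) : Sig := Sg.filter Decl.isLF

/-- Erasure of an LFR context to an LF context. -/
def Ctx.erase (Γ : Ctx) : LFCtx := Γ.map Prod.snd

/-! ### Weakening: `shift k` makes room for a new variable at index `k` -/

mutual
def Atm.shift (k : ℕ) : Atm → Atm
  | .const c => .const c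
  | .var i => .var (if i < k then i else i + 1)
  | .app R N => .app (R.shift k) (N.shift k)
def Nrm.shift (k : ℕ) : Nrm → Nrm
  | .atom R => .atom (R.shift k)
  | .lam N => .lam (N.shift (k + 1))
end

def ATy.shift (k : ℕ) : ATy → ATy
  | .const a => .const a
  | .app P N => .app (P.shift k) (N.shift k)

def Ty.shift (k : ℕ) : Ty → Ty
  | .atom P => .atom (P.shift k)
  | .pi A B => .pi (A.shift k) (B.shift (k + 1))

def ASrt.shift (k : ℕ) : ASrt → ASrt
  | .const s => .const s
  | .app Q N => .app (Q.shift k) (N.shift k)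

def Srt.shift (k : ℕ) : Srt → Srt
  | .atom Q => .atom (Q.shift k)
  | .pi S A T => .pi (S.shift k) (A.shift k) (T.shift (k + 1))
  | .top => .top
  | .inter S T => .inter (S.shift k) (T.shift k)

/-! ### Simple types, erasure of dependencies, η-expansion -/

/-- Simple types `α ::= a | α₁ → α₂`. -/
inductive STy : Type
  | base (a : ℕ) : STy
  | arr (α β : STy) : STy

/-- The head constant of an atomic type family. -/
def ATy.head : ATy → ℕ
  | .const a => a
  | .app P _ => P.head

/-- Erasure of a type family to a simple type. -/
def Ty.erase : Ty → STy
  | .atom P => .base P.head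
  | .pi A B => .arr A.erase B.erase

/-- η-expansion of an atomic term at a simple type:
`η_a(R) = R` and `η_{α→β}(R) = λx. η_β(R η_α(x))`. -/
def expand : STy → Atm → Nrm
  | .base _, R => .atom R
  | .arr α β, R => .lam (expand β (.app (R.shift 0) (expand α (.var 0))))

/-! ### Hereditary substitution

`SubN N₀ k α₀ N Nᵣ` says that the hereditary substitution `[N₀/x₀]_{α₀} N` is defined and equals
`Nᵣ`, where `x₀` is the variable with index `k` in `N`.  Variable `k` is removed, so variables
beyond it are renumbered; `N₀` and the result live in the context without `x₀`. -/

mutual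
/-- Substitution into normal terms. -/
inductive SubN : Nrm → ℕ → STy → Nrm → Nrm → Prop
  | atom {N₀ k α₀ R Rᵣ} : SubRR N₀ k α₀ R Rᵣ → SubN N₀ k α₀ (.atom R) (.atom Rᵣ)
  | atomNorm {N₀ k α₀ R Rᵣ a} :
      SubRN N₀ k α₀ R (.atom Rᵣ) (.base a) → SubN N₀ k α₀ (.atom R) (.atom Rᵣ)
  | lam {N₀ k α₀ N Nᵣ} :
      SubN (N₀.shift 0) (k + 1) α₀ N Nᵣ → SubN N₀ k α₀ (.lam N) (.lam Nᵣ)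
/-- Substitution into atomic terms whose head is not `x₀`, yielding an atomic term. -/
inductive SubRR : Nrm → ℕ → STy → Atm → Atm → Prop
  | varLt {N₀ k α₀ i} : i < k → SubRR N₀ k α₀ (.var i) (.var i)
  | varGt {N₀ k α₀ i} : k ≤ i → SubRR N₀ k α₀ (.var (i + 1)) (.var i)
  | const {N₀ k α₀ c} : SubRR N₀ k α₀ (.const c) (.const c)
  | app {N₀ k α₀ R Rᵣ N Nᵣ} : SubRR N₀ k α₀ R Rᵣ → SubN N₀ k α₀ N Nᵣ →
      SubRR N₀ k α₀ (.app R N) (.app Rᵣ Nᵣ)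
/-- Substitution into atomic terms whose head is `x₀`, yielding a normal term and a simple type. -/
inductive SubRN : Nrm → ℕ → STy → Atm → Nrm → STy → Prop
  | var {N₀ k α₀} : SubRN N₀ k α₀ (.var k) N₀ α₀
  | beta {N₀ k α₀ R₁ N₁ N₁ᵣ N₂ N₂ᵣ α₁ α₂} :
      SubRN N₀ k α₀ R₁ (.lam N₁) (.arr α₂ α₁) → SubN N₀ k α₀ N₂ N₂ᵣ →
      SubN N₂ᵣ 0 α₂ N₁ N₁ᵣ → SubRN N₀ k α₀ (.app R₁ N₂) N₁ᵣ α₁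
end

/-- Substitution into atomic types. -/
inductive SubP : Nrm → ℕ → STy → ATy → ATy → Prop
  | const {N₀ k α₀ a} : SubP N₀ k α₀ (.const a) (.const a)
  | app {N₀ k α₀ P Pᵣ N Nᵣ} : SubP N₀ k α₀ P Pᵣ → SubN N₀ k α₀ N Nᵣ →
      SubP N₀ k α₀ (.app P N) (.app Pᵣ Nᵣ)

/-- Substitution into types. -/
inductive SubA : Nrm → ℕ → STy → Ty → Ty → Prop
  | atom {N₀ k α₀ P Pᵣ} : SubP N₀ k α₀ P Pᵣ → SubA N₀ k α₀ (.atom P) (.atom Pᵣ)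
  | pi {N₀ k α₀ A Aᵣ B Bᵣ} : SubA N₀ k α₀ A Aᵣ → SubA (N₀.shift 0) (k + 1) α₀ B Bᵣ →
      SubA N₀ k α₀ (.pi A B) (.pi Aᵣ Bᵣ)

/-- Substitution into atomic sorts. -/
inductive SubQ : Nrm → ℕ → STy → ASrt → ASrt → Prop
  | const {N₀ k α₀ s} : SubQ N₀ k α₀ (.const s) (.const s)
  | app {N₀ k α₀ Q Qᵣ N Nᵣ} : SubQ N₀ k α₀ Q Qᵣ → SubN N₀ k α₀ N Nᵣ →
      SubQ N₀ k α₀ (.app Q N) (.app Qᵣ Nᵣ)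

/-- Substitution into sorts. -/
inductive SubS : Nrm → ℕ → STy → Srt → Srt → Prop
  | atom {N₀ k α₀ Q Qᵣ} : SubQ N₀ k α₀ Q Qᵣ → SubS N₀ k α₀ (.atom Q) (.atom Qᵣ)
  | pi {N₀ k α₀ S Sᵣ A Aᵣ T Tᵣ} : SubS N₀ k α₀ S Sᵣ → SubA N₀ k α₀ A Aᵣ →
      SubS (N₀.shift 0) (k + 1) α₀ T Tᵣ → SubS N₀ k α₀ (.pi S A T) (.pi Sᵣ Aᵣ Tᵣ)
  | top {N₀ k α₀} : SubS N₀ k α₀ .top .top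
  | inter {N₀ k α₀ S Sᵣ T Tᵣ} : SubS N₀ k α₀ S Sᵣ → SubS N₀ k α₀ T Tᵣ →
      SubS N₀ k α₀ (.inter S T) (.inter Sᵣ Tᵣ)

/-- Substitution into kinds. -/
inductive SubK : Nrm → ℕ → STy → Knd → Knd → Prop
  | type {N₀ k α₀} : SubK N₀ k α₀ .type .type
  | pi {N₀ k α₀ A Aᵣ K Kᵣ} : SubA N₀ k α₀ A Aᵣ → SubK (N₀.shift 0) (k + 1) α₀ K Kᵣ →
      SubK N₀ k α₀ (.pi A K) (.pi Aᵣ Kᵣ)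

/-- Substitution into classes. -/
inductive SubL : Nrm → ℕ → STy → Cls → Cls → Prop
  | sort {N₀ k α₀} : SubL N₀ k α₀ .sort .sort
  | pi {N₀ k α₀ S Sᵣ A Aᵣ L Lᵣ} : SubS N₀ k α₀ S Sᵣ → SubA N₀ k α₀ A Aᵣ →
      SubL (N₀.shift 0) (k + 1) α₀ L Lᵣ → SubL N₀ k α₀ (.pi S A L) (.pi Sᵣ Aᵣ Lᵣ)
  | top {N₀ k α₀} : SubL N₀ k α₀ .top .top
  | inter {N₀ k α₀ L₁ L₁ᵣ L₂ L₂ᵣ} : SubL N₀ k α₀ L₁ L₁ᵣ → SubL N₀ k α₀ L₂ L₂ᵣ →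
      SubL N₀ k α₀ (.inter L₁ L₂) (.inter L₁ᵣ L₂ᵣ)

/-! ### Canonical LF -/

/-- `x:A ∈ Γ`, with `A` weakened to the whole context. -/
inductive LFLookup : LFCtx → ℕ → Ty → Prop
  | here {Γ A} : LFLookup (A :: Γ) 0 (A.shift 0)
  | there {Γ i A B} : LFLookup Γ i A → LFLookup (B :: Γ) (i + 1) (A.shift 0)

mutual
/-- `Γ ⊢ R ⇒ A` in LF. -/
inductive LFSynth (Sg : Sig) : LFCtx → Atm → Ty → Prop
  | const {Γ c A} : Decl.tmDecl c A ∈ Sg → LFSynth Sg Γ (.const c) A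
  | var {Γ i A} : LFLookup Γ i A → LFSynth Sg Γ (.var i) A
  | app {Γ R N A B Bᵣ} : LFSynth Sg Γ R (.pi A B) → LFCheck Sg Γ N A →
      SubA N 0 A.erase B Bᵣ → LFSynth Sg Γ (.app R N) Bᵣ
/-- `Γ ⊢ N ⇐ A` in LF. -/
inductive LFCheck (Sg : Sig) : LFCtx → Nrm → Ty → Prop
  | atom {Γ R P} : LFSynth Sg Γ R (.atom P) → LFCheck Sg Γ (.atom R) (.atom P)
  | lam {Γ N A B} : LFCheck Sg (A :: Γ) N B → LFCheck Sg Γ (.lam N) (.pi A B)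
end

/-- `Γ ⊢ P ⇒ K` in LF. -/
inductive LFSynthKind (Sg : Sig) : LFCtx → ATy → Knd → Prop
  | const {Γ a K} : Decl.tyDecl a K ∈ Sg → LFSynthKind Sg Γ (.const a) K
  | app {Γ P N A K Kᵣ} : LFSynthKind Sg Γ P (.pi A K) → LFCheck Sg Γ N A →
      SubK N 0 A.erase K Kᵣ → LFSynthKind Sg Γ (.app P N) Kᵣ

/-- `Γ ⊢ A ⇐ type` in LF. -/
inductive LFType (Sg : Sig) : LFCtx → Ty → Prop
  | atom {Γ P} : LFSynthKind Sg Γ P .type → LFType Sg Γ (.atom P)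
  | pi {Γ A B} : LFType Sg Γ A → LFType Sg (A :: Γ) B → LFType Sg Γ (.pi A B)

/-- `Γ ⊢ K ⇐ kind` in LF. -/
inductive LFKind (Sg : Sig) : LFCtx → Knd → Prop
  | type {Γ} : LFKind Sg Γ .type
  | pi {Γ A K} : LFType Sg Γ A → LFKind Sg (A :: Γ) K → LFKind Sg Γ (.pi A K)

/-- `⊢ Γ ctx` in LF. -/
inductive LFCtxWf (Sg : Sig) : LFCtx → Prop
  | nil : LFCtxWf Sg []
  | cons {Γ A} : LFCtxWf Sg Γ → LFType Sg Γ A → LFCtxWf Sg (A :: Γ)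

/-! ### Sort checking -/

/-- `x::S⊏A ∈ Γ`, with `S` and `A` weakened to the whole context. -/
inductive Lookup : Ctx → ℕ → Srt → Ty → Prop
  | here {Γ S A} : Lookup ((S, A) :: Γ) 0 (S.shift 0) (A.shift 0)
  | there {Γ i S A e} : Lookup Γ i S A → Lookup (e :: Γ) (i + 1) (S.shift 0) (A.shift 0)

/-- One declared subsorting step between atomic sorts: `s₁ N₁ … Nₙ ≤ s₂ N₁ … Nₙ` for a
declaration `s₁ ≤ s₂` of the signature. -/
inductive SubStep (Sg : Sig) : ASrt → ASrt → Prop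
  | decl {s₁ s₂} : Decl.subDecl s₁ s₂ ∈ Sg → SubStep Sg (.const s₁) (.const s₂)
  | app {Q₁ Q₂ N} : SubStep Sg Q₁ Q₂ → SubStep Sg (.app Q₁ N) (.app Q₂ N)

/-- Subsorting `Q₁ ≤ Q₂` on atomic sorts. -/
inductive AtomSub (Sg : Sig) : ASrt → ASrt → Prop
  | refl {Q} : AtomSub Sg Q Q
  | step {Q₁ Q Q₂} : SubStep Sg Q₁ Q → AtomSub Sg Q Q₂ → AtomSub Sg Q₁ Q₂

mutual
/-- `Γ ⊢ R ⇒ S`. -/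
inductive Synth (Sg : Sig) : Ctx → Atm → Srt → Prop
  | const {Γ c S} : Decl.tmRef c S ∈ Sg → Synth Sg Γ (.const c) S
  | var {Γ i S A} : Lookup Γ i S A → Synth Sg Γ (.var i) S
  | app {Γ R N S A T Tᵣ} : Synth Sg Γ R (.pi S A T) → Check Sg Γ N S →
      SubS N 0 A.erase T Tᵣ → Synth Sg Γ (.app R N) Tᵣ
  | interE₁ {Γ R S₁ S₂} : Synth Sg Γ R (.inter S₁ S₂) → Synth Sg Γ R S₁
  | interE₂ {Γ R S₁ S₂} : Synth Sg Γ R (.inter S₁ S₂) → Synth Sg Γ R S₂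
/-- `Γ ⊢ N ⇐ S`. -/
inductive Check (Sg : Sig) : Ctx → Nrm → Srt → Prop
  | switch {Γ R Q₀ Q} : Synth Sg Γ R (.atom Q₀) → AtomSub Sg Q₀ Q →
      Check Sg Γ (.atom R) (.atom Q)
  | lam {Γ N S A T} : Check Sg ((S, A) :: Γ) N T → Check Sg Γ (.lam N) (.pi S A T)
  | top {Γ N} : Check Sg Γ N .top
  | inter {Γ N S₁ S₂} : Check Sg Γ N S₁ → Check Sg Γ N S₂ → Check Sg Γ N (.inter S₁ S₂)
end

/-! ### Formation of sorts, classes, contexts and signatures -/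

/-- `Γ ⊢ Q ⊏ P ⇒ L`. -/
inductive SynthClass (Sg : Sig) : Ctx → ASrt → ATy → Cls → Prop
  | const {Γ s a L} : Decl.srtRef s a L ∈ Sg → SynthClass Sg Γ (.const s) (.const a) L
  | app {Γ Q P N S A L Lᵣ} : SynthClass Sg Γ Q P (.pi S A L) → Check Sg Γ N S →
      SubL N 0 A.erase L Lᵣ → SynthClass Sg Γ (.app Q N) (.app P N) Lᵣ
  | interE₁ {Γ Q P L₁ L₂} : SynthClass Sg Γ Q P (.inter L₁ L₂) → SynthClass Sg Γ Q P L₁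
  | interE₂ {Γ Q P L₁ L₂} : SynthClass Sg Γ Q P (.inter L₁ L₂) → SynthClass Sg Γ Q P L₂

/-- `Γ ⊢ S ⊏ A`. -/
inductive Refines (Sg : Sig) : Ctx → Srt → Ty → Prop
  | atom {Γ Q P} : SynthClass Sg Γ Q P .sort → Refines Sg Γ (.atom Q) (.atom P)
  | pi {Γ S A T B} : Refines Sg Γ S A → Refines Sg ((S, A) :: Γ) T B →
      Refines Sg Γ (.pi S A T) (.pi A B)
  | top {Γ A} : Refines Sg Γ .top A
  | inter {Γ S₁ S₂ A} : Refines Sg Γ S₁ A → Refines Sg Γ S₂ A → Refines Sg Γ (.inter S₁ S₂) A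

/-- `Γ ⊢ L ⊏ K`. -/
inductive ClassRefines (Sg : Sig) : Ctx → Cls → Knd → Prop
  | sort {Γ} : ClassRefines Sg Γ .sort .type
  | pi {Γ S A L K} : Refines Sg Γ S A → ClassRefines Sg ((S, A) :: Γ) L K →
      ClassRefines Sg Γ (.pi S A L) (.pi A K)
  | top {Γ K} : ClassRefines Sg Γ .top K
  | inter {Γ L₁ L₂ K} : ClassRefines Sg Γ L₁ K → ClassRefines Sg Γ L₂ K →
      ClassRefines Sg Γ (.inter L₁ L₂) K

/-- `⊢ Γ ctx`. -/
inductive CtxWf (Sg : Sig) : Ctx → Prop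
  | nil : CtxWf Sg []
  | cons {Γ S A} : CtxWf Sg Γ → Refines Sg Γ S A → CtxWf Sg ((S, A) :: Γ)

/-- `⊢ Σ sig`. -/
inductive SigWf : Sig → Prop
  | nil : SigWf []
  | tyDecl {Sg a K} : SigWf Sg → LFKind (Sig.erase Sg) [] K →
      (∀ K₀, Decl.tyDecl a K₀ ∉ Sg) → SigWf (.tyDecl a K :: Sg)
  | tmDecl {Sg c A} : SigWf Sg → LFType (Sig.erase Sg) [] A →
      (∀ A₀, Decl.tmDecl c A₀ ∉ Sg) → SigWf (.tmDecl c A :: Sg)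
  | srtRef {Sg s a L K} : SigWf Sg → Decl.tyDecl a K ∈ Sg → ClassRefines Sg [] L K →
      (∀ a₀ L₀, Decl.srtRef s a₀ L₀ ∉ Sg) → SigWf (.srtRef s a L :: Sg)
  | tmRef {Sg c S A} : SigWf Sg → Decl.tmDecl c A ∈ Sg → Refines Sg [] S A →
      (∀ S₀, Decl.tmRef c S₀ ∉ Sg) → SigWf (.tmRef c S :: Sg)
  | subDecl {Sg s₁ s₂ a L} : SigWf Sg → Decl.srtRef s₁ a L ∈ Sg → Decl.srtRef s₂ a L ∈ Sg →
      SigWf (.subDecl s₁ s₂ :: Sg)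

/-! ### Declarative subsorting at higher sorts -/

/-- `Γ ⊢ S₁ ≤ S₂ ⊏ A`: the usual rules for subsorting at arbitrary sorts, extending the
subsorting relation on atomic sorts (rule `atom`).  No rule demands that the sorts it
mentions be well-formed. -/
inductive DeclSub (Sg : Sig) : Ctx → Srt → Srt → Ty → Prop
  | atom {Γ Q₁ Q₂ P} : AtomSub Sg Q₁ Q₂ → DeclSub Sg Γ (.atom Q₁) (.atom Q₂) (.atom P)
  | refl {Γ S A} : DeclSub Sg Γ S S A
  | trans {Γ S₁ S₂ S₃ A} : DeclSub Sg Γ S₁ S₂ A → DeclSub Sg Γ S₂ S₃ A → DeclSub Sg Γ S₁ S₃ A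
  | pi {Γ S₁ S₂ T₁ T₂ A B} : DeclSub Sg Γ S₂ S₁ A → DeclSub Sg ((S₂, A) :: Γ) T₁ T₂ B →
      DeclSub Sg Γ (.pi S₁ A T₁) (.pi S₂ A T₂) (.pi A B)
  | topR {Γ S A} : DeclSub Sg Γ S .top A
  | interR {Γ T S₁ S₂ A} : DeclSub Sg Γ T S₁ A → DeclSub Sg Γ T S₂ A →
      DeclSub Sg Γ T (.inter S₁ S₂) A
  | interL₁ {Γ S₁ S₂ T A} : DeclSub Sg Γ S₁ T A → DeclSub Sg Γ (.inter S₁ S₂) T A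
  | interL₂ {Γ S₁ S₂ T A} : DeclSub Sg Γ S₂ T A → DeclSub Sg Γ (.inter S₁ S₂) T A
  | topPi {Γ S A B} : DeclSub Sg Γ .top (.pi S A .top) (.pi A B)
  | interPi {Γ S T₁ T₂ A B} :
      DeclSub Sg Γ (.inter (.pi S A T₁) (.pi S A T₂)) (.pi S A (.inter T₁ T₂)) (.pi A B)

end LFR

/-! Sorts are interpreted by a Kripke logical relation on atomic terms: `R` inhabits `Πx::S⊏A. T`
if in every renaming of the context `R η_A(y)` inhabits `T[y/x]` whenever the variable `y`
inhabits `S`. Each subsorting rule, the distributivity laws included, is an inclusion of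
interpretations, and transitivity is composition of inclusions. By simultaneous induction on
sorts, a term that synthesizes `S` inhabits `S`, and the η-expansion of an inhabitant of `T`
checks against `T`. The relation only ever substitutes η-expanded variables, and `[η_α(y)/x]_α`
does nothing but rename `x` to `y`, by induction on the simple type `α`. -/

namespace LFR

/-! ### Renaming -/

/-- Renamings of de Bruijn indices. -/
abbrev Ren := ℕ → ℕ

/-- The renaming behind `shift k`: it makes room for a new variable at index `k`. -/
def skip (k : ℕ) : Ren := fun i => if i < k then i else i + 1

/-- Extension of a renaming by the value `y` at the most recent variable. -/
def scons (y : ℕ) (ρ : Ren) : Ren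
  | 0 => y
  | i + 1 => ρ i

/-- The lifting of a renaming under a binder. -/
def up (ρ : Ren) : Ren := scons 0 (skip 0 ∘ ρ)

/-- The renaming behind the substitution of the variable `y` for the variable `k`, which is removed;
`y` counts without `k`. -/
def contract (k y : ℕ) : Ren := fun i => if i < k then i else if i = k then y else i - 1

theorem skip_of_lt {k i : ℕ} (h : i < k) : skip k i = i := if_pos h

theorem skip_of_le {k i : ℕ} (h : k ≤ i) : skip k i = i + 1 := if_neg h.not_gt

@[simp] theorem skip_zero (i : ℕ) : skip 0 i = i + 1 := rfl

@[simp] theorem up_zero (ρ : Ren) : up ρ 0 = 0 := rfl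

@[simp] theorem up_succ (ρ : Ren) (i : ℕ) : up ρ (i + 1) = ρ i + 1 := rfl

theorem eq_or_exists_eq_skip (k i : ℕ) : i = k ∨ ∃ j, i = skip k j := by
  rcases lt_trichotomy i k with h | h | h
  · exact .inr ⟨i, (skip_of_lt h).symm⟩
  · exact .inl h
  · exact .inr ⟨i - 1, by rw [skip_of_le (by omega)]; omega⟩

theorem contract_self (k y : ℕ) : contract k y k = y := by simp [contract]

theorem contract_skip (k y i : ℕ) : contract k y (skip k i) = i := by
  simp only [contract, skip]; split_ifs <;> omega

theorem contract_zero (y : ℕ) : contract 0 y = scons y id := by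
  funext i; cases i <;> rfl

theorem up_skip (k : ℕ) : up (skip k) = skip (k + 1) := by
  funext i
  cases i with
  | zero => rfl
  | succ i => simp only [up_succ, skip]; split_ifs <;> omega

theorem up_contract (k y : ℕ) : up (contract k y) = contract (k + 1) (y + 1) := by
  funext i
  cases i with
  | zero => rfl
  | succ i => simp only [up_succ, contract]; split_ifs <;> omega

theorem up_comp (ρ τ : Ren) : up (ρ ∘ τ) = up ρ ∘ up τ := by
  funext i; cases i <;> rfl

theorem up_comp_skip_zero (ρ : Ren) : up ρ ∘ skip 0 = skip 0 ∘ ρ := rfl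

theorem scons_comp_up (y : ℕ) (τ ρ : Ren) : scons y τ ∘ up ρ = scons y (τ ∘ ρ) := by
  funext i; cases i <;> rfl

mutual
/-- Renaming of an atomic term. -/
def Atm.ren (ρ : Ren) : Atm → Atm
  | .const c => .const c
  | .var i => .var (ρ i)
  | .app R N => .app (R.ren ρ) (N.ren ρ)
/-- Renaming of a normal term. -/
def Nrm.ren (ρ : Ren) : Nrm → Nrm
  | .atom R => .atom (R.ren ρ)
  | .lam N => .lam (N.ren (up ρ))
end

/-- Renaming of an atomic type. -/
def ATy.ren (ρ : Ren) : ATy → ATy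
  | .const a => .const a
  | .app P N => .app (P.ren ρ) (N.ren ρ)

/-- Renaming of a type. -/
def Ty.ren (ρ : Ren) : Ty → Ty
  | .atom P => .atom (P.ren ρ)
  | .pi A B => .pi (A.ren ρ) (B.ren (up ρ))

/-- Renaming of an atomic sort. -/
def ASrt.ren (ρ : Ren) : ASrt → ASrt
  | .const s => .const s
  | .app Q N => .app (Q.ren ρ) (N.ren ρ)

/-- Renaming of a sort. -/
def Srt.ren (ρ : Ren) : Srt → Srt
  | .atom Q => .atom (Q.ren ρ)
  | .pi S A T => .pi (S.ren ρ) (A.ren ρ) (T.ren (up ρ))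
  | .top => .top
  | .inter S T => .inter (S.ren ρ) (T.ren ρ)

mutual
theorem Atm.shift_eq_ren (k : ℕ) : ∀ R : Atm, R.shift k = R.ren (skip k)
  | .const _ => rfl
  | .var _ => rfl
  | .app R N => by simp only [Atm.shift, Atm.ren, R.shift_eq_ren k, N.shift_eq_ren k]
theorem Nrm.shift_eq_ren (k : ℕ) : ∀ N : Nrm, N.shift k = N.ren (skip k)
  | .atom R => by simp only [Nrm.shift, Nrm.ren, R.shift_eq_ren k]
  | .lam N => by simp only [Nrm.shift, Nrm.ren, up_skip, N.shift_eq_ren (k + 1)]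
end

theorem ATy.shift_eq_ren (k : ℕ) (P : ATy) : P.shift k = P.ren (skip k) := by
  induction P with
  | const => rfl
  | app _ _ ih => simp only [ATy.shift, ATy.ren, ih, Nrm.shift_eq_ren]

theorem Ty.shift_eq_ren (k : ℕ) (A : Ty) : A.shift k = A.ren (skip k) := by
  induction A generalizing k with
  | atom => simp only [Ty.shift, Ty.ren, ATy.shift_eq_ren]
  | pi _ _ ihA ihB => simp only [Ty.shift, Ty.ren, ihA, ihB, up_skip]

theorem ASrt.shift_eq_ren (k : ℕ) (Q : ASrt) : Q.shift k = Q.ren (skip k) := by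
  induction Q with
  | const => rfl
  | app _ _ ih => simp only [ASrt.shift, ASrt.ren, ih, Nrm.shift_eq_ren]

theorem Srt.shift_eq_ren (k : ℕ) (S : Srt) : S.shift k = S.ren (skip k) := by
  induction S generalizing k with
  | atom => simp only [Srt.shift, Srt.ren, ASrt.shift_eq_ren]
  | pi _ _ _ ihS ihT => simp only [Srt.shift, Srt.ren, ihS, ihT, Ty.shift_eq_ren, up_skip]
  | top => rfl
  | inter _ _ ihS ihT => simp only [Srt.shift, Srt.ren, ihS, ihT]

mutual
theorem Atm.ren_ren (ρ τ : Ren) : ∀ R : Atm, (R.ren τ).ren ρ = R.ren (ρ ∘ τ)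
  | .const _ => rfl
  | .var _ => rfl
  | .app R N => by simp only [Atm.ren, R.ren_ren ρ τ, N.ren_ren ρ τ]
theorem Nrm.ren_ren (ρ τ : Ren) : ∀ N : Nrm, (N.ren τ).ren ρ = N.ren (ρ ∘ τ)
  | .atom R => by simp only [Nrm.ren, R.ren_ren ρ τ]
  | .lam N => by simp only [Nrm.ren, up_comp, N.ren_ren (up ρ) (up τ)]
end

theorem ATy.ren_ren (ρ τ : Ren) (P : ATy) : (P.ren τ).ren ρ = P.ren (ρ ∘ τ) := by
  induction P with
  | const => rfl
  | app _ _ ih => simp only [ATy.ren, ih, Nrm.ren_ren]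

theorem Ty.ren_ren (ρ τ : Ren) (A : Ty) : (A.ren τ).ren ρ = A.ren (ρ ∘ τ) := by
  induction A generalizing ρ τ with
  | atom => simp only [Ty.ren, ATy.ren_ren]
  | pi _ _ ihA ihB => simp only [Ty.ren, ihA, ihB, up_comp]

theorem ASrt.ren_ren (ρ τ : Ren) (Q : ASrt) : (Q.ren τ).ren ρ = Q.ren (ρ ∘ τ) := by
  induction Q with
  | const => rfl
  | app _ _ ih => simp only [ASrt.ren, ih, Nrm.ren_ren]

theorem Srt.ren_ren (ρ τ : Ren) (S : Srt) : (S.ren τ).ren ρ = S.ren (ρ ∘ τ) := by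
  induction S generalizing ρ τ with
  | atom => simp only [Srt.ren, ASrt.ren_ren]
  | pi _ _ _ ihS ihT => simp only [Srt.ren, ihS, ihT, Ty.ren_ren, up_comp]
  | top => rfl
  | inter _ _ ihS ihT => simp only [Srt.ren, ihS, ihT]

theorem Atm.shift_zero_ren_up (R : Atm) (ρ : Ren) :
    (R.shift 0).ren (up ρ) = (R.ren ρ).shift 0 := by
  simp only [Atm.shift_eq_ren, Atm.ren_ren, up_comp_skip_zero]

theorem Nrm.shift_zero_ren_up (N : Nrm) (ρ : Ren) :
    (N.shift 0).ren (up ρ) = (N.ren ρ).shift 0 := by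
  simp only [Nrm.shift_eq_ren, Nrm.ren_ren, up_comp_skip_zero]

theorem Ty.shift_zero_ren_up (A : Ty) (ρ : Ren) :
    (A.shift 0).ren (up ρ) = (A.ren ρ).shift 0 := by
  simp only [Ty.shift_eq_ren, Ty.ren_ren, up_comp_skip_zero]

theorem Srt.shift_zero_ren_up (S : Srt) (ρ : Ren) :
    (S.shift 0).ren (up ρ) = (S.ren ρ).shift 0 := by
  simp only [Srt.shift_eq_ren, Srt.ren_ren, up_comp_skip_zero]

theorem ATy.head_ren (ρ : Ren) (P : ATy) : (P.ren ρ).head = P.head := by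
  induction P with
  | const => rfl
  | app _ _ ih => exact ih

@[simp] theorem Ty.erase_ren (ρ : Ren) (A : Ty) : (A.ren ρ).erase = A.erase := by
  induction A generalizing ρ with
  | atom => simp only [Ty.ren, Ty.erase, ATy.head_ren]
  | pi _ _ ihA ihB => simp only [Ty.ren, Ty.erase, ihA, ihB]

@[simp] theorem Ty.erase_shift (k : ℕ) (A : Ty) : (A.shift k).erase = A.erase := by
  rw [Ty.shift_eq_ren, Ty.erase_ren]

theorem expand_ren (α : STy) (R : Atm) (ρ : Ren) :
    (expand α R).ren ρ = expand α (R.ren ρ) := by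
  induction α generalizing R ρ with
  | base => rfl
  | arr α β ihα ihβ =>
    simp only [expand, Nrm.ren, Atm.ren, ihα, ihβ, Atm.shift_zero_ren_up, up_zero]

theorem expand_shift (k : ℕ) (α : STy) (R : Atm) :
    (expand α R).shift k = expand α (R.shift k) := by
  rw [Nrm.shift_eq_ren, expand_ren, Atm.shift_eq_ren]

/-! ### Renaming and hereditary substitution -/

section Substitution

variable {N₀ : Nrm} {k k' : ℕ} {α₀ : STy} {ρ ρ' : Ren}

theorem SubP.head_eq {P P' : ATy} (h : SubP N₀ k α₀ P P') : P'.head = P.head := by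
  induction h with
  | const => rfl
  | app _ _ ih => exact ih

theorem SubA.erase_eq {A A' : Ty} (h : SubA N₀ k α₀ A A') : A'.erase = A.erase := by
  induction h with
  | atom h => simp only [Ty.erase, h.head_eq]
  | pi _ _ ihA ihB => simp only [Ty.erase, ihA, ihB]

/-- The renaming `ρ'` is `ρ` with the assignment `k ↦ k'` inserted.  Substitution for `k` followed
by `ρ` then agrees with `ρ'` followed by substitution for `k'`. -/
def Inserts (k k' : ℕ) (ρ ρ' : Ren) : Prop :=
  ρ' k = k' ∧ ∀ i, ρ' (skip k i) = skip k' (ρ i)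

theorem Inserts.up (h : Inserts k k' ρ ρ') : Inserts (k + 1) (k' + 1) (up ρ) (up ρ') := by
  refine ⟨by simp only [up_succ, h.1], fun i => ?_⟩
  rw [← up_skip, ← up_skip]
  cases i with
  | zero => rfl
  | succ i => simp only [up_succ, h.2 i]

theorem inserts_up (ρ : Ren) : Inserts 0 0 ρ (up ρ) :=
  ⟨rfl, fun _ => rfl⟩

theorem inserts_skip_zero (k : ℕ) : Inserts k (k + 1) (skip 0) (skip 0) := by
  refine ⟨rfl, fun i => ?_⟩
  rw [← up_skip, skip_zero, skip_zero, up_succ]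

theorem SubRR.var_skip (i : ℕ) : SubRR N₀ k α₀ (.var (skip k i)) (.var i) := by
  rcases lt_or_ge i k with h | h
  · rw [skip_of_lt h]
    exact .varLt h
  · rw [skip_of_le h]
    exact .varGt h

theorem Inserts.subRR_var (h : Inserts k k' ρ ρ') (i : ℕ) :
    SubRR N₀ k' α₀ (.var (ρ' (skip k i))) (.var (ρ i)) := by
  rw [h.2]
  exact .var_skip _

mutual
theorem SubN.ren {N₀ : Nrm} {k : ℕ} {α₀ : STy} {N N' : Nrm} : SubN N₀ k α₀ N N' →
    ∀ {k' ρ ρ'}, Inserts k k' ρ ρ' → SubN (N₀.ren ρ) k' α₀ (N.ren ρ') (N'.ren ρ)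
  | .atom h, _, _, _, hρ => .atom (h.ren hρ)
  | .atomNorm h, _, _, _, hρ => .atomNorm (h.ren hρ)
  | .lam h, _, ρ, _, hρ => .lam (N₀.shift_zero_ren_up ρ ▸ h.ren hρ.up)
theorem SubRR.ren {N₀ : Nrm} {k : ℕ} {α₀ : STy} {R R' : Atm} : SubRR N₀ k α₀ R R' →
    ∀ {k' ρ ρ'}, Inserts k k' ρ ρ' → SubRR (N₀.ren ρ) k' α₀ (R.ren ρ') (R'.ren ρ)
  | .varLt (i := i) h, _, _, _, hρ => by simpa only [Atm.ren, skip_of_lt h] using hρ.subRR_var i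
  | .varGt (i := i) h, _, _, _, hρ => by simpa only [Atm.ren, skip_of_le h] using hρ.subRR_var i
  | .const, _, _, _, _ => .const
  | .app hR hN, _, _, _, hρ => .app (hR.ren hρ) (hN.ren hρ)
theorem SubRN.ren {N₀ : Nrm} {k : ℕ} {α₀ : STy} {R : Atm} {N' : Nrm} {α : STy} :
    SubRN N₀ k α₀ R N' α →
    ∀ {k' ρ ρ'}, Inserts k k' ρ ρ' → SubRN (N₀.ren ρ) k' α₀ (R.ren ρ') (N'.ren ρ) α
  | .var, _, _, _, hρ => by
    rw [Atm.ren, hρ.1]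
    exact .var
  | .beta hR hN hβ, _, ρ, _, hρ => .beta (hR.ren hρ) (hN.ren hρ) (hβ.ren (inserts_up ρ))
end

theorem SubRR.shift_zero {R R' : Atm} (h : SubRR N₀ k α₀ R R') :
    SubRR (N₀.shift 0) (k + 1) α₀ (R.shift 0) (R'.shift 0) := by
  simpa only [Atm.shift_eq_ren, Nrm.shift_eq_ren] using h.ren (inserts_skip_zero k)

theorem SubRN.shift_zero {R : Atm} {N' : Nrm} {α : STy} (h : SubRN N₀ k α₀ R N' α) :
    SubRN (N₀.shift 0) (k + 1) α₀ (R.shift 0) (N'.shift 0) α := by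
  simpa only [Atm.shift_eq_ren, Nrm.shift_eq_ren] using h.ren (inserts_skip_zero k)

theorem SubP.ren {P P' : ATy} (h : SubP N₀ k α₀ P P') (hρ : Inserts k k' ρ ρ') :
    SubP (N₀.ren ρ) k' α₀ (P.ren ρ') (P'.ren ρ) := by
  induction h with
  | const => exact .const
  | app _ hN ih => exact .app ih (hN.ren hρ)

theorem SubA.ren {A A' : Ty} (h : SubA N₀ k α₀ A A') (hρ : Inserts k k' ρ ρ') :
    SubA (N₀.ren ρ) k' α₀ (A.ren ρ') (A'.ren ρ) := by
  induction h generalizing k' ρ ρ' with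
  | atom h => exact .atom (h.ren hρ)
  | pi _ _ ihA ihB => exact .pi (ihA hρ) (Nrm.shift_zero_ren_up _ ρ ▸ ihB hρ.up)

theorem SubQ.ren {Q Q' : ASrt} (h : SubQ N₀ k α₀ Q Q') (hρ : Inserts k k' ρ ρ') :
    SubQ (N₀.ren ρ) k' α₀ (Q.ren ρ') (Q'.ren ρ) := by
  induction h with
  | const => exact .const
  | app _ hN ih => exact .app ih (hN.ren hρ)

theorem SubS.ren {S S' : Srt} (h : SubS N₀ k α₀ S S') (hρ : Inserts k k' ρ ρ') :
    SubS (N₀.ren ρ) k' α₀ (S.ren ρ') (S'.ren ρ) := by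
  induction h generalizing k' ρ ρ' with
  | atom h => exact .atom (h.ren hρ)
  | pi _ hA _ ihS ihT =>
    exact .pi (ihS hρ) (hA.ren hρ) (Nrm.shift_zero_ren_up _ ρ ▸ ihT hρ.up)
  | top => exact .top
  | inter _ _ ihS ihT => exact .inter (ihS hρ) (ihT hρ)

mutual
theorem SubRR.of_shift (α₀ : STy) : ∀ (N₀ : Nrm) (k : ℕ) (R : Atm), SubRR N₀ k α₀ (R.shift k) R
  | _, _, .const _ => .const
  | _, _, .var i => .var_skip i
  | N₀, k, .app R N => .app (.of_shift α₀ N₀ k R) (.of_shift α₀ N₀ k N)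
theorem SubN.of_shift (α₀ : STy) : ∀ (N₀ : Nrm) (k : ℕ) (N : Nrm), SubN N₀ k α₀ (N.shift k) N
  | N₀, k, .atom R => .atom (.of_shift α₀ N₀ k R)
  | N₀, k, .lam N => .lam (.of_shift α₀ (N₀.shift 0) (k + 1) N)
end

theorem SubRR.subN_expand {R R' : Atm} (β : STy) (h : SubRR N₀ k α₀ R R') :
    SubN N₀ k α₀ (expand β R) (expand β R') := by
  induction β generalizing N₀ k R R' with
  | base => exact .atom h
  | arr α β ihα ihβ => exact .lam (ihβ (.app h.shift_zero (ihα (.varLt k.succ_pos))))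

end Substitution

/-! ### Simple typing -/

mutual
/-- Simple typing of atomic terms.  A constant may be used at any simple type: no signature is
consulted, because substitution for a variable is guided by the types of variables alone. -/
inductive Atm.HasSTy : List STy → Atm → STy → Prop
  | const {Δ : List STy} {c : ℕ} {α : STy} : Atm.HasSTy Δ (.const c) α
  | var {Δ : List STy} {i : ℕ} {α : STy} : Δ[i]? = some α → Atm.HasSTy Δ (.var i) α
  | app {Δ : List STy} {R : Atm} {N : Nrm} {α β : STy} :
      Atm.HasSTy Δ R (.arr α β) → Nrm.HasSTy Δ N α → Atm.HasSTy Δ (.app R N) β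
/-- Simple typing of normal terms; typable terms are η-long. -/
inductive Nrm.HasSTy : List STy → Nrm → STy → Prop
  | atom {Δ : List STy} {R : Atm} {a : ℕ} :
      Atm.HasSTy Δ R (.base a) → Nrm.HasSTy Δ (.atom R) (.base a)
  | lam {Δ : List STy} {N : Nrm} {α β : STy} :
      Nrm.HasSTy (α :: Δ) N β → Nrm.HasSTy Δ (.lam N) (.arr α β)
end

/-- The arguments of an atomic type are simply typed. -/
inductive ATy.IsSimplyTyped : List STy → ATy → Prop
  | const {Δ : List STy} {a : ℕ} : ATy.IsSimplyTyped Δ (.const a)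
  | app {Δ : List STy} {P : ATy} {N : Nrm} {α : STy} :
      ATy.IsSimplyTyped Δ P → Nrm.HasSTy Δ N α → ATy.IsSimplyTyped Δ (.app P N)

/-- The terms occurring in a type are simply typed. -/
inductive Ty.IsSimplyTyped : List STy → Ty → Prop
  | atom {Δ : List STy} {P : ATy} : ATy.IsSimplyTyped Δ P → Ty.IsSimplyTyped Δ (.atom P)
  | pi {Δ : List STy} {A B : Ty} :
      Ty.IsSimplyTyped Δ A → Ty.IsSimplyTyped (A.erase :: Δ) B → Ty.IsSimplyTyped Δ (.pi A B)

/-- The arguments of an atomic sort are simply typed. -/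
inductive ASrt.IsSimplyTyped : List STy → ASrt → Prop
  | const {Δ : List STy} {s : ℕ} : ASrt.IsSimplyTyped Δ (.const s)
  | app {Δ : List STy} {Q : ASrt} {N : Nrm} {α : STy} :
      ASrt.IsSimplyTyped Δ Q → Nrm.HasSTy Δ N α → ASrt.IsSimplyTyped Δ (.app Q N)

/-- `Srt.RefinesSTy Δ S α`: the sort `S` refines the simple type `α`, and the terms occurring in it
are simply typed.  This is what the well-formedness judgment `Γ ⊢ S ⊏ A` retains at the level of
simple types. -/
inductive Srt.RefinesSTy : List STy → Srt → STy → Prop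
  | atom {Δ : List STy} {Q : ASrt} {a : ℕ} :
      ASrt.IsSimplyTyped Δ Q → Srt.RefinesSTy Δ (.atom Q) (.base a)
  | pi {Δ : List STy} {S : Srt} {A : Ty} {T : Srt} {β : STy} :
      Srt.RefinesSTy Δ S A.erase → Ty.IsSimplyTyped Δ A → Srt.RefinesSTy (A.erase :: Δ) T β →
      Srt.RefinesSTy Δ (.pi S A T) (.arr A.erase β)
  | top {Δ : List STy} {α : STy} : Srt.RefinesSTy Δ .top α
  | inter {Δ : List STy} {S T : Srt} {α : STy} :
      Srt.RefinesSTy Δ S α → Srt.RefinesSTy Δ T α → Srt.RefinesSTy Δ (.inter S T) α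

/-- Erasure of an LF context to a context of simple types. -/
def LFCtx.simple (Γ : LFCtx) : List STy := Γ.map Ty.erase

section Erasure

variable {Sg : Sig}

theorem LFLookup.getElem?_simple {Γ : LFCtx} {i : ℕ} {A : Ty} (h : LFLookup Γ i A) :
    Γ.simple[i]? = some A.erase := by
  induction h with
  | here => simp [LFCtx.simple]
  | there _ ih => simpa [LFCtx.simple] using ih

mutual
theorem LFSynth.hasSTy {Γ : LFCtx} {R : Atm} {A : Ty} :
    LFSynth Sg Γ R A → Atm.HasSTy Γ.simple R A.erase
  | .const _ => .const
  | .var h => .var h.getElem?_simple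
  | .app hR hN hB => hB.erase_eq ▸ .app hR.hasSTy hN.hasSTy
theorem LFCheck.hasSTy {Γ : LFCtx} {N : Nrm} {A : Ty} :
    LFCheck Sg Γ N A → Nrm.HasSTy Γ.simple N A.erase
  | .atom h => .atom h.hasSTy
  | .lam h => .lam h.hasSTy
end

theorem LFSynthKind.isSimplyTyped {Γ : LFCtx} {P : ATy} {K : Knd} (h : LFSynthKind Sg Γ P K) :
    ATy.IsSimplyTyped Γ.simple P := by
  induction h with
  | const _ => exact .const
  | app _ hN _ ih => exact .app ih hN.hasSTy

theorem LFType.isSimplyTyped {Γ : LFCtx} {A : Ty} (h : LFType Sg Γ A) :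
    Ty.IsSimplyTyped Γ.simple A := by
  induction h with
  | atom h => exact .atom h.isSimplyTyped
  | pi _ _ ihA ihB => exact .pi ihA ihB

variable {Γ : Ctx} {Δ : List STy}

theorem SynthClass.isSimplyTyped {Q : ASrt} {P : ATy} {L : Cls} (h : SynthClass Sg Γ Q P L)
    (hP : ATy.IsSimplyTyped Δ P) : ASrt.IsSimplyTyped Δ Q := by
  induction h with
  | const _ => exact .const
  | app _ _ _ ih =>
    cases hP with
    | app hP hN => exact .app (ih hP) hN
  | interE₁ _ ih => exact ih hP
  | interE₂ _ ih => exact ih hP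

theorem Refines.refinesSTy {S : Srt} {A : Ty} (h : Refines Sg Γ S A)
    (hA : Ty.IsSimplyTyped Δ A) : Srt.RefinesSTy Δ S A.erase := by
  induction h generalizing Δ with
  | atom h =>
    cases hA with
    | atom hP => exact .atom (h.isSimplyTyped hP)
  | pi _ _ ihS ihT =>
    cases hA with
    | pi hA hB => exact .pi (ihS hA) hA (ihT hB)
  | top => exact .top
  | inter _ _ ihS ihT => exact .inter (ihS hA) (ihT hA)

end Erasure

/-- `IsTypedRen Δ ρ Δ'`: the renaming `ρ` takes the variables of `Δ` to variables of `Δ'` of the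
same simple type. -/
def IsTypedRen (Δ : List STy) (ρ : Ren) (Δ' : List STy) : Prop :=
  ∀ i α, Δ[i]? = some α → Δ'[ρ i]? = some α

section TypedRenaming

variable {Δ Δ' Δ'' : List STy} {α : STy} {ρ τ : Ren}

theorem isTypedRen_id (Δ : List STy) : IsTypedRen Δ id Δ := fun _ _ h => h

theorem isTypedRen_skip_zero (Δ : List STy) (α : STy) : IsTypedRen Δ (skip 0) (α :: Δ) :=
  fun _ _ h => h

theorem IsTypedRen.comp (hτ : IsTypedRen Δ' τ Δ'') (hρ : IsTypedRen Δ ρ Δ') :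
    IsTypedRen Δ (τ ∘ ρ) Δ'' :=
  fun i α h => hτ (ρ i) α (hρ i α h)

theorem IsTypedRen.scons (hρ : IsTypedRen Δ ρ Δ') {y : ℕ} (hy : Δ'[y]? = some α) :
    IsTypedRen (α :: Δ) (scons y ρ) Δ'
  | 0, _, h => h ▸ hy
  | i + 1, β, h => hρ i β h

theorem IsTypedRen.up (hρ : IsTypedRen Δ ρ Δ') (α : STy) :
    IsTypedRen (α :: Δ) (up ρ) (α :: Δ') :=
  ((isTypedRen_skip_zero Δ' α).comp hρ).scons rfl

theorem isTypedRen_contract_zero {y : ℕ} (hy : Δ[y]? = some α) :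
    IsTypedRen (α :: Δ) (contract 0 y) Δ :=
  contract_zero y ▸ (isTypedRen_id Δ).scons hy

mutual
theorem Atm.HasSTy.ren {Δ : List STy} {R : Atm} {α : STy} : Atm.HasSTy Δ R α →
    ∀ {ρ Δ'}, IsTypedRen Δ ρ Δ' → Atm.HasSTy Δ' (R.ren ρ) α
  | .const, _, _, _ => .const
  | .var h, _, _, hρ => .var (hρ _ _ h)
  | .app hR hN, _, _, hρ => .app (hR.ren hρ) (hN.ren hρ)
theorem Nrm.HasSTy.ren {Δ : List STy} {N : Nrm} {α : STy} : Nrm.HasSTy Δ N α →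
    ∀ {ρ Δ'}, IsTypedRen Δ ρ Δ' → Nrm.HasSTy Δ' (N.ren ρ) α
  | .atom h, _, _, hρ => .atom (h.ren hρ)
  | .lam h, _, _, hρ => .lam (h.ren (hρ.up _))
end

theorem ATy.IsSimplyTyped.ren {P : ATy} (h : ATy.IsSimplyTyped Δ P) (hρ : IsTypedRen Δ ρ Δ') :
    ATy.IsSimplyTyped Δ' (P.ren ρ) := by
  induction h with
  | const => exact .const
  | app _ hN ih => exact .app ih (hN.ren hρ)

theorem Ty.IsSimplyTyped.ren {A : Ty} (h : Ty.IsSimplyTyped Δ A) (hρ : IsTypedRen Δ ρ Δ') :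
    Ty.IsSimplyTyped Δ' (A.ren ρ) := by
  induction h generalizing ρ Δ' with
  | atom h => exact .atom (h.ren hρ)
  | pi _ _ ihA ihB => exact .pi (ihA hρ) (by rw [Ty.erase_ren]; exact ihB (hρ.up _))

theorem ASrt.IsSimplyTyped.ren {Q : ASrt} (h : ASrt.IsSimplyTyped Δ Q) (hρ : IsTypedRen Δ ρ Δ') :
    ASrt.IsSimplyTyped Δ' (Q.ren ρ) := by
  induction h with
  | const => exact .const
  | app _ hN ih => exact .app ih (hN.ren hρ)

theorem Srt.RefinesSTy.ren {S : Srt} (h : Srt.RefinesSTy Δ S α) (hρ : IsTypedRen Δ ρ Δ') :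
    Srt.RefinesSTy Δ' (S.ren ρ) α := by
  induction h generalizing ρ Δ' with
  | atom h => exact .atom (h.ren hρ)
  | @pi _ S A T _ _ hA _ ihS ihT =>
    rw [← Ty.erase_ren ρ A]
    exact .pi (Ty.erase_ren ρ A ▸ ihS hρ) (hA.ren hρ) (Ty.erase_ren ρ A ▸ ihT (hρ.up _))
  | top => exact .top
  | inter _ _ ihS ihT => exact .inter (ihS hρ) (ihT hρ)

theorem up_eq_self_of_lt {n : ℕ} (h : ∀ i < n, ρ i = i) : ∀ i < n + 1, up ρ i = i
  | 0, _ => rfl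
  | i + 1, hi => by rw [up_succ, h i (by omega)]

mutual
theorem Atm.HasSTy.ren_eq_self {Δ : List STy} {R : Atm} {α : STy} : Atm.HasSTy Δ R α →
    ∀ {ρ : Ren}, (∀ i < Δ.length, ρ i = i) → R.ren ρ = R
  | .const, _, _ => rfl
  | .var h, _, hρ => by rw [Atm.ren, hρ _ (List.getElem?_eq_some_iff.1 h).1]
  | .app hR hN, _, hρ => by rw [Atm.ren, hR.ren_eq_self hρ, hN.ren_eq_self hρ]
theorem Nrm.HasSTy.ren_eq_self {Δ : List STy} {N : Nrm} {α : STy} : Nrm.HasSTy Δ N α →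
    ∀ {ρ : Ren}, (∀ i < Δ.length, ρ i = i) → N.ren ρ = N
  | .atom h, _, hρ => by rw [Nrm.ren, h.ren_eq_self hρ]
  | .lam h, _, hρ => by rw [Nrm.ren, h.ren_eq_self (up_eq_self_of_lt hρ)]
end

theorem ATy.IsSimplyTyped.ren_eq_self {P : ATy} (h : ATy.IsSimplyTyped Δ P)
    (hρ : ∀ i < Δ.length, ρ i = i) : P.ren ρ = P := by
  induction h with
  | const => rfl
  | app _ hN ih => rw [ATy.ren, ih, hN.ren_eq_self hρ]

theorem Ty.IsSimplyTyped.ren_eq_self {A : Ty} (h : Ty.IsSimplyTyped Δ A)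
    (hρ : ∀ i < Δ.length, ρ i = i) : A.ren ρ = A := by
  induction h generalizing ρ with
  | atom h => rw [Ty.ren, h.ren_eq_self hρ]
  | pi _ _ ihA ihB => rw [Ty.ren, ihA hρ, ihB (up_eq_self_of_lt hρ)]

theorem ASrt.IsSimplyTyped.ren_eq_self {Q : ASrt} (h : ASrt.IsSimplyTyped Δ Q)
    (hρ : ∀ i < Δ.length, ρ i = i) : Q.ren ρ = Q := by
  induction h with
  | const => rfl
  | app _ hN ih => rw [ASrt.ren, ih, hN.ren_eq_self hρ]

theorem Srt.RefinesSTy.ren_eq_self {S : Srt} (h : Srt.RefinesSTy Δ S α)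
    (hρ : ∀ i < Δ.length, ρ i = i) : S.ren ρ = S := by
  induction h generalizing ρ with
  | atom h => rw [Srt.ren, h.ren_eq_self hρ]
  | pi _ hA _ ihS ihT =>
    rw [Srt.ren, ihS hρ, hA.ren_eq_self hρ, ihT (up_eq_self_of_lt hρ)]
  | top => rfl
  | inter _ _ ihS ihT => rw [Srt.ren, ihS hρ, ihT hρ]

end TypedRenaming

/-! ### Substitution of η-expanded variables -/

/-- The simple type `β` absorbs η-expansion: whenever substitution turns an atomic term `R` into a
normal term `M` of type `β`, it turns `η_β(R)` into `M` as well. -/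
def STy.AbsorbsExpand (β : STy) : Prop :=
  ∀ {Δ : List STy} {M : Nrm}, Nrm.HasSTy Δ M β → ∀ {N₀ : Nrm} {k : ℕ} {α₀ : STy} {R : Atm},
    SubRN N₀ k α₀ R M β → SubN N₀ k α₀ (expand β R) M

/-- The argument types of a simple type. -/
def STy.args : STy → List STy
  | .base _ => []
  | .arr α β => α :: β.args

theorem STy.AbsorbsExpand.subN_expand_app {α : STy} (hα : α.AbsorbsExpand) {Δ : List STy}
    {N : Nrm} (hN : Nrm.HasSTy Δ N α) (β : STy) (R : Atm) :
    SubN N 0 α (expand β (.app (R.shift 0) (expand α (.var 0)))) (expand β (.app R N)) :=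
  SubRR.subN_expand β (.app (.of_shift α N 0 R) (hα hN .var))

mutual
-- The head of `R` is either another variable or constant, or the variable `k` itself, whose type
-- `α` then bounds the types of the arguments that `R` still lacks.
theorem Atm.HasSTy.sub_expand_var_of_args {α : STy} (hα : ∀ γ ∈ α.args, γ.AbsorbsExpand)
    {Δ : List STy} {R : Atm} {β : STy} : Atm.HasSTy Δ R β →
    ∀ {k y Δ'}, Δ[k]? = some α → IsTypedRen Δ (contract k y) Δ' →
    SubRR (expand α (.var y)) k α R (R.ren (contract k y)) ∨
      SubRN (expand α (.var y)) k α R (expand β (R.ren (contract k y))) β ∧ β.args ⊆ α.args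
  | .const, _, _, _, _, _ => .inl .const
  | .var (i := i) h, k, y, _, hk, _ => by
    rw [Atm.ren]
    rcases eq_or_exists_eq_skip k i with rfl | ⟨j, rfl⟩
    · obtain rfl := Option.some.inj (h.symm.trans hk)
      rw [contract_self]
      exact .inr ⟨.var, List.Subset.refl _⟩
    · rw [contract_skip]
      exact .inl (.var_skip j)
  | .app hR hN, _, _, _, hk, hy => by
    have hN' := hN.subN_expand_var_of_args hα hk hy
    rcases hR.sub_expand_var_of_args hα hk hy with hR' | ⟨hR', hargs⟩
    · exact .inl (.app hR' hN')
    · obtain ⟨hmem, hsub⟩ := List.cons_subset.1 hargs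
      have hβ := STy.AbsorbsExpand.subN_expand_app (hα _ hmem) (hN.ren hy)
      exact .inr ⟨.beta hR' hN' (hβ _ _), hsub⟩
theorem Nrm.HasSTy.subN_expand_var_of_args {α : STy} (hα : ∀ γ ∈ α.args, γ.AbsorbsExpand)
    {Δ : List STy} {N : Nrm} {β : STy} : Nrm.HasSTy Δ N β →
    ∀ {k y Δ'}, Δ[k]? = some α → IsTypedRen Δ (contract k y) Δ' →
    SubN (expand α (.var y)) k α N (N.ren (contract k y))
  | .atom h, _, _, _, hk, hy =>
    (h.sub_expand_var_of_args hα hk hy).elim .atom fun h' => .atomNorm h'.1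
  | .lam h, k, y, _, hk, hy => by
    refine .lam ?_
    rw [expand_shift, up_contract]
    exact h.subN_expand_var_of_args hα hk (up_contract k y ▸ hy.up _)
end

theorem STy.AbsorbsExpand.arr {α β : STy} (hα : ∀ γ ∈ α.args, γ.AbsorbsExpand)
    (hβ : β.AbsorbsExpand) : (STy.arr α β).AbsorbsExpand := by
  intro Δ M hM N₀ k α₀ R hR
  cases hM with
  | @lam _ M _ _ hM =>
    have hM' : Nrm.HasSTy (α :: α :: Δ) (M.shift 1) β := by
      rw [Nrm.shift_eq_ren, ← up_skip]
      exact hM.ren ((isTypedRen_skip_zero Δ α).up α)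
    have h_contract : (M.shift 1).ren (contract 0 0) = M := by
      rw [Nrm.shift_eq_ren, Nrm.ren_ren, ← up_skip, contract_zero, scons_comp_up]
      exact hM.ren_eq_self fun i _ => by cases i <;> rfl
    have hβred : SubN (expand α (.var 0)) 0 α (M.shift 1) M := by
      simpa only [h_contract] using
        hM'.subN_expand_var_of_args hα rfl (isTypedRen_contract_zero (y := 0) rfl)
    exact .lam (hβ hM (.beta hR.shift_zero (SubRR.subN_expand α (.varLt k.succ_pos)) hβred))

theorem STy.absorbsExpand_and_args (β : STy) :
    β.AbsorbsExpand ∧ ∀ γ ∈ β.args, γ.AbsorbsExpand := by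
  induction β with
  | base =>
    refine ⟨fun hM _ _ _ _ hR => ?_, List.forall_mem_nil _⟩
    cases hM
    exact .atomNorm hR
  | arr α β ihα ihβ => exact ⟨STy.AbsorbsExpand.arr ihα.2 ihβ.1,
    List.forall_mem_cons.2 ⟨ihα.1, ihβ.2⟩⟩

section SubstExpand

variable {Δ Δ' : List STy} {α : STy} {k y : ℕ}

theorem Nrm.HasSTy.subN_expand_var {N : Nrm} {β : STy} (h : Nrm.HasSTy Δ N β)
    (hk : Δ[k]? = some α) (hy : IsTypedRen Δ (contract k y) Δ') :
    SubN (expand α (.var y)) k α N (N.ren (contract k y)) :=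
  h.subN_expand_var_of_args α.absorbsExpand_and_args.2 hk hy

theorem ATy.IsSimplyTyped.subP_expand_var {P : ATy} (h : ATy.IsSimplyTyped Δ P)
    (hk : Δ[k]? = some α) (hy : IsTypedRen Δ (contract k y) Δ') :
    SubP (expand α (.var y)) k α P (P.ren (contract k y)) := by
  induction h with
  | const => exact .const
  | app _ hN ih => exact .app ih (hN.subN_expand_var hk hy)

theorem Ty.IsSimplyTyped.subA_expand_var {A : Ty} (h : Ty.IsSimplyTyped Δ A)
    (hk : Δ[k]? = some α) (hy : IsTypedRen Δ (contract k y) Δ') :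
    SubA (expand α (.var y)) k α A (A.ren (contract k y)) := by
  induction h generalizing k y Δ' with
  | atom h => exact .atom (h.subP_expand_var hk hy)
  | pi _ _ ihA ihB =>
    refine .pi (ihA hk hy) ?_
    rw [expand_shift, up_contract]
    exact ihB hk (up_contract k y ▸ hy.up _)

theorem ASrt.IsSimplyTyped.subQ_expand_var {Q : ASrt} (h : ASrt.IsSimplyTyped Δ Q)
    (hk : Δ[k]? = some α) (hy : IsTypedRen Δ (contract k y) Δ') :
    SubQ (expand α (.var y)) k α Q (Q.ren (contract k y)) := by
  induction h with
  | const => exact .const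
  | app _ hN ih => exact .app ih (hN.subN_expand_var hk hy)

theorem Srt.RefinesSTy.subS_expand_var {S : Srt} {β : STy} (h : Srt.RefinesSTy Δ S β)
    (hk : Δ[k]? = some α) (hy : IsTypedRen Δ (contract k y) Δ') :
    SubS (expand α (.var y)) k α S (S.ren (contract k y)) := by
  induction h generalizing k y Δ' with
  | atom h => exact .atom (h.subQ_expand_var hk hy)
  | pi _ hA _ ihS ihT =>
    refine .pi (ihS hk hy) (hA.subA_expand_var hk hy) ?_
    rw [expand_shift, up_contract]
    exact ihT hk (up_contract k y ▸ hy.up _)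
  | top => exact .top
  | inter _ _ ihS ihT => exact .inter (ihS hk hy) (ihT hk hy)

theorem Srt.RefinesSTy.subS_expand_scons {T : Srt} {β : STy} (h : Srt.RefinesSTy (α :: Δ) T β)
    {ρ : Ren} (hρ : IsTypedRen Δ ρ Δ') (hy : Δ'[y]? = some α) :
    SubS (expand α (.var y)) 0 α (T.ren (up ρ)) (T.ren (scons y ρ)) := by
  have hsub := (h.ren (hρ.up α)).subS_expand_var rfl (isTypedRen_contract_zero hy)
  rwa [Srt.ren_ren, contract_zero, scons_comp_up, Function.id_comp] at hsub

end SubstExpand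

/-! ### Renaming of sort checking -/

/-- The sorts that a signature assigns to term constants are closed, expressed as invariance under
all renamings. -/
def Sig.HasClosedSorts (Sg : Sig) : Prop :=
  ∀ c S, Decl.tmRef c S ∈ Sg → ∀ ρ, S.ren ρ = S

theorem SigWf.isSimplyTyped_of_tmDecl {Sg : Sig} {c : ℕ} {A : Ty} (h : SigWf Sg)
    (hc : Decl.tmDecl c A ∈ Sg) : Ty.IsSimplyTyped [] A := by
  induction h with
  | nil => simp at hc
  | tmDecl _ hA _ ih =>
    rcases List.mem_cons.1 hc with h | h
    · cases h
      exact hA.isSimplyTyped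
    · exact ih h
  | _ => simp_all

theorem SigWf.hasClosedSorts {Sg : Sig} (h : SigWf Sg) : Sg.HasClosedSorts := by
  intro c S hc ρ
  induction h with
  | nil => simp at hc
  | tmRef hSg hA hS _ ih =>
    rcases List.mem_cons.1 hc with h | h
    · cases h
      exact (hS.refinesSTy (hSg.isSimplyTyped_of_tmDecl hA)).ren_eq_self (by simp)
    · exact ih h
  | _ => simp_all

/-- `IsCtxRen Γ ξ Γ'`: the renaming `ξ` takes declarations of `Γ` to declarations of `Γ'`. -/
def IsCtxRen (Γ : Ctx) (ξ : Ren) (Γ' : Ctx) : Prop :=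
  ∀ i S A, Lookup Γ i S A → Lookup Γ' (ξ i) (S.ren ξ) (A.ren ξ)

section CtxRenaming

variable {Sg : Sig} {Γ Γ' : Ctx} {ξ : Ren}

theorem isCtxRen_skip_zero (Γ : Ctx) (e : Srt × Ty) : IsCtxRen Γ (skip 0) (e :: Γ) := by
  intro i S A h
  rw [← Srt.shift_eq_ren, ← Ty.shift_eq_ren]
  exact .there h

theorem IsCtxRen.up (h : IsCtxRen Γ ξ Γ') (S : Srt) (A : Ty) :
    IsCtxRen ((S, A) :: Γ) (up ξ) ((S.ren ξ, A.ren ξ) :: Γ') := by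
  intro i S' A' hi
  cases hi with
  | here =>
    rw [Srt.shift_zero_ren_up, Ty.shift_zero_ren_up]
    exact .here
  | there hi =>
    rw [Srt.shift_zero_ren_up, Ty.shift_zero_ren_up]
    exact .there (h _ _ _ hi)

theorem getElem?_erase_simple_eq_some_iff {i : ℕ} {α : STy} :
    Γ.erase.simple[i]? = some α ↔ ∃ S A, Lookup Γ i S A ∧ A.erase = α := by
  constructor
  · intro h
    induction Γ generalizing i with
    | nil => simp [Ctx.erase, LFCtx.simple] at h
    | cons e Γ ih =>
      cases i with
      | zero => exact ⟨_, _, .here, by simpa [Ctx.erase, LFCtx.simple] using h⟩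
      | succ i =>
        obtain ⟨S, A, hi, rfl⟩ := ih (i := i) h
        exact ⟨_, _, .there hi, Ty.erase_shift 0 A⟩
  · rintro ⟨S, A, hi, rfl⟩
    induction hi with
    | here => simp [Ctx.erase, LFCtx.simple]
    | there _ ih => simpa [Ctx.erase, LFCtx.simple] using ih

theorem IsCtxRen.isTypedRen (h : IsCtxRen Γ ξ Γ') :
    IsTypedRen Γ.erase.simple ξ Γ'.erase.simple := by
  intro i α hi
  obtain ⟨S, A, hlookup, rfl⟩ := getElem?_erase_simple_eq_some_iff.1 hi
  exact getElem?_erase_simple_eq_some_iff.2 ⟨_, _, h i S A hlookup, Ty.erase_ren ξ A⟩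

theorem SubStep.ren {Q₁ Q₂ : ASrt} (h : SubStep Sg Q₁ Q₂) (ρ : Ren) :
    SubStep Sg (Q₁.ren ρ) (Q₂.ren ρ) := by
  induction h with
  | decl h => exact .decl h
  | app _ ih => exact .app ih

theorem AtomSub.ren {Q₁ Q₂ : ASrt} (h : AtomSub Sg Q₁ Q₂) (ρ : Ren) :
    AtomSub Sg (Q₁.ren ρ) (Q₂.ren ρ) := by
  induction h with
  | refl => exact .refl
  | step h _ ih => exact .step (h.ren ρ) ih

theorem AtomSub.trans {Q₁ Q₂ Q₃ : ASrt} (h : AtomSub Sg Q₁ Q₂) (h' : AtomSub Sg Q₂ Q₃) :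
    AtomSub Sg Q₁ Q₃ := by
  induction h with
  | refl => exact h'
  | step h _ ih => exact .step h (ih h')

mutual
theorem Synth.ren (hSg : Sg.HasClosedSorts) {Γ : Ctx} {R : Atm} {S : Srt} : Synth Sg Γ R S →
    ∀ {ξ Γ'}, IsCtxRen Γ ξ Γ' → Synth Sg Γ' (R.ren ξ) (S.ren ξ)
  | .const h, ξ, _, _ => by
    rw [hSg _ _ h ξ]
    exact .const h
  | .var h, _, _, hξ => .var (hξ _ _ _ h)
  | .app (A := A) hR hN hT, ξ, _, hξ =>
    .app (hR.ren hSg hξ) (hN.ren hSg hξ) ((A.erase_ren ξ).symm ▸ hT.ren (inserts_up ξ))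
  | .interE₁ h, _, _, hξ => .interE₁ (h.ren hSg hξ)
  | .interE₂ h, _, _, hξ => .interE₂ (h.ren hSg hξ)
theorem Check.ren (hSg : Sg.HasClosedSorts) {Γ : Ctx} {N : Nrm} {S : Srt} : Check Sg Γ N S →
    ∀ {ξ Γ'}, IsCtxRen Γ ξ Γ' → Check Sg Γ' (N.ren ξ) (S.ren ξ)
  | .switch h hQ, ξ, _, hξ => .switch (h.ren hSg hξ) (hQ.ren ξ)
  | .lam h, _, _, hξ => .lam (h.ren hSg (hξ.up _ _))
  | .top, _, _, _ => .top
  | .inter h₁ h₂, _, _, hξ => .inter (h₁.ren hSg hξ) (h₂.ren hSg hξ)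
end

theorem Check.of_atomSub {R : Atm} {Q₁ Q₂ : ASrt} (h : Check Sg Γ (.atom R) (.atom Q₁))
    (hQ : AtomSub Sg Q₁ Q₂) : Check Sg Γ (.atom R) (.atom Q₂) := by
  cases h with
  | switch hR hQ₁ => exact .switch hR (hQ₁.trans hQ)

end CtxRenaming

/-! ### The Kripke interpretation of sorts -/

/-- `Inhabits Sg S ρ Γ R`: in the context `Γ`, the atomic term `R` behaves like an inhabitant of the
sort `S` renamed by `ρ`.  Functions are tested on η-expanded variables only, in all renamings of
`Γ`.  The renaming is kept apart from the sort so that the definition is structurally recursive. -/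
def Inhabits (Sg : Sig) : Srt → Ren → Ctx → Atm → Prop
  | .atom Q, ρ, Γ, R => Check Sg Γ (.atom R) (.atom (Q.ren ρ))
  | .pi S A T, ρ, Γ, R => ∀ Γ' ξ, IsCtxRen Γ ξ Γ' → ∀ y, Γ'.erase.simple[y]? = some A.erase →
      Inhabits Sg S (ξ ∘ ρ) Γ' (.var y) →
      Inhabits Sg T (scons y (ξ ∘ ρ)) Γ' (.app (R.ren ξ) (expand A.erase (.var y)))
  | .top, _, _, _ => True
  | .inter S T, ρ, Γ, R => Inhabits Sg S ρ Γ R ∧ Inhabits Sg T ρ Γ R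

section Interpretation

variable {Sg : Sig} {Γ Γ₀ : Ctx} {S T : Srt} {A : Ty} {R : Atm} {ρ : Ren} {Δ : List STy} {α : STy}

theorem DeclSub.inhabits (h : DeclSub Sg Γ₀ S T A) (hR : Inhabits Sg S ρ Γ R) :
    Inhabits Sg T ρ Γ R := by
  induction h generalizing ρ Γ R with
  | atom hQ => exact Check.of_atomSub hR (hQ.ren ρ)
  | refl => exact hR
  | trans _ _ ih₁ ih₂ => exact ih₂ (ih₁ hR)
  | pi _ _ ihS ihT => exact fun Γ' ξ hξ y hy hyS => ihT (hR Γ' ξ hξ y hy (ihS hyS))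
  | topR => exact trivial
  | interR _ _ ih₁ ih₂ => exact ⟨ih₁ hR, ih₂ hR⟩
  | interL₁ _ ih => exact ih hR.1
  | interL₂ _ ih => exact ih hR.2
  | topPi => exact fun _ _ _ _ _ _ => trivial
  | interPi => exact fun Γ' ξ hξ y hy hyS => ⟨hR.1 Γ' ξ hξ y hy hyS, hR.2 Γ' ξ hξ y hy hyS⟩

mutual
theorem Synth.inhabits {Sg : Sig} (hSg : Sg.HasClosedSorts) {Δ : List STy} {S : Srt} {α : STy} :
    Srt.RefinesSTy Δ S α → ∀ {ρ Γ R}, IsTypedRen Δ ρ Γ.erase.simple →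
    Synth Sg Γ R (S.ren ρ) → Inhabits Sg S ρ Γ R
  | .atom _, _, _, _, _, hR => .switch hR .refl
  | .pi hS _ hT, ρ, _, _, hρ, hR => by
    intro Γ' ξ hξ y hy hyS
    have hξρ := hξ.isTypedRen.comp hρ
    have hRξ := hR.ren hSg hξ
    rw [Srt.ren_ren] at hRξ
    refine Synth.inhabits hSg hT (hξρ.scons hy) (.app hRξ (Inhabits.check_expand hSg hS hξρ hyS) ?_)
    rw [Ty.erase_ren]
    exact hT.subS_expand_scons hξρ hy
  | .top, _, _, _, _, _ => trivial
  | .inter hS hT, _, _, _, hρ, hR =>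
    ⟨Synth.inhabits hSg hS hρ (.interE₁ hR), Synth.inhabits hSg hT hρ (.interE₂ hR)⟩
theorem Inhabits.check_expand {Sg : Sig} (hSg : Sg.HasClosedSorts) {Δ : List STy} {S : Srt}
    {α : STy} : Srt.RefinesSTy Δ S α → ∀ {ρ Γ R}, IsTypedRen Δ ρ Γ.erase.simple →
    Inhabits Sg S ρ Γ R → Check Sg Γ (expand α R) (S.ren ρ)
  | .atom _, _, _, _, _, hR => hR
  | .pi (S := S) (A := A) hS _ hT, ρ, Γ, R, hρ, hR => by
    have hξ := isCtxRen_skip_zero Γ (S.ren ρ, A.ren ρ)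
    have hξρ := hξ.isTypedRen.comp hρ
    have h_zero : (Ctx.erase ((S.ren ρ, A.ren ρ) :: Γ)).simple[0]? = some A.erase :=
      congrArg some (A.erase_ren ρ)
    have h_var : Inhabits Sg S (skip 0 ∘ ρ) ((S.ren ρ, A.ren ρ) :: Γ) (.var 0) := by
      refine Synth.inhabits hSg hS hξρ ?_
      rw [← Srt.ren_ren, ← Srt.shift_eq_ren]
      exact .var .here
    refine .lam ?_
    rw [Atm.shift_eq_ren]
    exact Inhabits.check_expand hSg hT (hξρ.scons h_zero) (hR _ _ hξ 0 h_zero h_var)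
  | .top, _, _, _, _, _ => .top
  | .inter hS hT, _, _, _, hρ, hR =>
    .inter (Inhabits.check_expand hSg hS hρ hR.1) (Inhabits.check_expand hSg hT hρ hR.2)
end

theorem DeclSub.check_expand (hST : DeclSub Sg Γ₀ S T A) (hSg : Sg.HasClosedSorts)
    (hS : Srt.RefinesSTy Δ S α) (hT : Srt.RefinesSTy Δ T α) (hρ : IsTypedRen Δ ρ Γ.erase.simple)
    (hR : Synth Sg Γ R (S.ren ρ)) : Check Sg Γ (expand α R) (T.ren ρ) :=
  Inhabits.check_expand hSg hT hρ (hST.inhabits (Synth.inhabits hSg hS hρ hR))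

end Interpretation

end LFR

theorem mainTheorem5_general (Sg : LFR.Sig) (Γ : LFR.Ctx) (S T : LFR.Srt) (A : LFR.Ty)
    (hSg : Sg.HasClosedSorts)
    (hS : S.RefinesSTy Γ.erase.simple A.erase) (hT : T.RefinesSTy Γ.erase.simple A.erase)
    (hST : LFR.DeclSub Sg Γ S T A) :
    LFR.Check Sg ((S, A) :: Γ) (LFR.expand A.erase (.var 0)) (T.shift 0) := by
  rw [LFR.Srt.shift_eq_ren]
  refine hST.check_expand hSg hS hT (LFR.isCtxRen_skip_zero Γ (S, A)).isTypedRen ?_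
  rw [← LFR.Srt.shift_eq_ren]
  exact .var .here

/-- Soundness of declarative subsorting: if `Γ ⊢ S ≤ T ⊏ A`, then `Γ, x::S⊏A ⊢ η_A(x) ⇐ T`.
The hypotheses before the last say that the subjects of the judgments are well-formed. -/
theorem mainTheorem5 (Sg : LFR.Sig) (Γ : LFR.Ctx) (S T : LFR.Srt) (A : LFR.Ty)
    (hSg : LFR.SigWf Sg)
    (hΓ : LFR.CtxWf Sg Γ) (hΓLF : LFR.LFCtxWf (LFR.Sig.erase Sg) (LFR.Ctx.erase Γ))
    (hA : LFR.LFType (LFR.Sig.erase Sg) (LFR.Ctx.erase Γ) A)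
    (hS : LFR.Refines Sg Γ S A) (hT : LFR.Refines Sg Γ T A)
    (hST : LFR.DeclSub Sg Γ S T A) :
    LFR.Check Sg ((S, A) :: Γ) (LFR.expand A.erase (.var 0)) (T.shift 0) := by
  have hA' := hA.isSimplyTyped
  exact mainTheorem5_general Sg Γ S T A hSg.hasClosedSorts
    (hS.refinesSTy hA') (hT.refinesSTy hA') hST
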